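/- Let $d,k\ge 1$ be integers and $\nu>0$. For a finite set $V\subset\mathbb R^d$ and $r\ge 0$ let $G_r(V)$ be the graph with vertex set $V$ in which two distinct points are adjacent iff their Euclidean distance is at most $r$, and let $N_{k,r}(V)$ be the maximum number of vertices of $G_r(V)$ that can be properly coloured with $k$ colours (the largest size of a set $S\subseteq V$ such that the subgraph induced on $S$ is $k$-colourable). Let $\mathcal X_\nu$ be a homogeneous Poisson point process of intensity $\nu$ on $\mathbb R^d$, and put \[ a_{k,\nu}=\inf_{t>0}\frac{\mathbb E\bigl[N_{k,1}([0,t]^d\cap\mathcal X_\nu)\bigr]}{\nu t^d}. \] For every $n\ge1$ let $\mathcal I_n$ be a collection of $n$ independent points, each uniformly distributed in $[0,1]^d$, all defined on one common probability space; no assumption is made on the joint distribution of $\mathcal I_1,\mathcal I_2,\dots$ for different $n$ (in particular, they may be the initial segments of one i.i.d. sequence). Then, with $H_{k,r}(n)=N_{k,r}(\mathcal I_n)$, almost surely \[ \lim_{n\to\infty}\frac{H_{k,\sqrt[d]{\nu/n}}(n)}{n}=a_{k,\nu}. \] -/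

import Mathlib

open MeasureTheory ProbabilityTheory Filter Topology
open scoped Function

/-- The random geometric graph `G_r(V)`: the vertices are the points of `V`, and two distinct
points are adjacent iff their Euclidean distance is at most `r`. -/
def geomGraph {d : ℕ} (r : ℝ) (V : Set (EuclideanSpace ℝ (Fin d))) : SimpleGraph V where
  Adj u v := u ≠ v ∧ dist u v ≤ r
  symm := ⟨fun _ _ h => ⟨h.1.symm, by rw [dist_comm]; exact h.2⟩⟩
  loopless := ⟨fun _ h => h.1 rfl⟩

/-- The maximum number of vertices of the graph `G` that can be properly coloured with `k`
colours, i.e. the largest size of a finite set of vertices inducing a `k`-colourable subgraph.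
(Only used for graphs with finitely many vertices, where the supremum is a maximum.) -/
noncomputable def maxColoured {V : Type*} (G : SimpleGraph V) (k : ℕ) : ℕ :=
  sSup {m : ℕ | ∃ S : Finset V, S.card = m ∧ (G.induce (S : Set V)).Colorable k}

/-- `N_{k,r}(V)`. -/
noncomputable def numColoured {d : ℕ} (k : ℕ) (r : ℝ) (V : Set (EuclideanSpace ℝ (Fin d))) : ℕ :=
  maxColoured (geomGraph r V) k

/-- The cube `[0, t]^d`. -/
def cube (d : ℕ) (t : ℝ) : Set (EuclideanSpace ℝ (Fin d)) :=
  {x | ∀ i, x i ∈ Set.Icc 0 t}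

/-- `X` is a (homogeneous) Poisson point process on `ℝ^d` with intensity `lam`, defined on the
probability space `(Ω, P)`: a random locally finite set of points such that the number of points
in each bounded Borel set `B` is Poisson distributed with mean `lam * vol B`, and the numbers of
points in finitely many pairwise disjoint bounded Borel sets are independent. -/
structure IsPoissonPointProcess {d : ℕ} {Ω : Type*} [MeasurableSpace Ω] (lam : ℝ)
    (X : Ω → Set (EuclideanSpace ℝ (Fin d))) (P : Measure Ω) : Prop where
  locallyFinite : ∀ ω, ∀ B : Set (EuclideanSpace ℝ (Fin d)), Bornology.IsBounded B →
    (X ω ∩ B).Finite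
  hasLaw_count : ∀ B : Set (EuclideanSpace ℝ (Fin d)), MeasurableSet B → Bornology.IsBounded B →
    HasLaw (fun ω => (X ω ∩ B).ncard) (poissonMeasure (lam * volume.real B).toNNReal) P
  indep_count : ∀ (m : ℕ) (B : Fin m → Set (EuclideanSpace ℝ (Fin d))),
    (∀ i, MeasurableSet (B i)) → (∀ i, Bornology.IsBounded (B i)) → Pairwise (Disjoint on B) →
    iIndepFun (fun i ω => (X ω ∩ B i).ncard) P

/-- `F_{k,lam}(t) = N_{k,1}([0,t]^d ∩ X)`, as a random variable; `X` is the Poisson process of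
intensity `lam`. -/
noncomputable def poissonColoured {d : ℕ} {Ω : Type*}
    (X : Ω → Set (EuclideanSpace ℝ (Fin d))) (k : ℕ) (t : ℝ) (ω : Ω) : ℕ :=
  numColoured k 1 (cube d t ∩ X ω)

/-- The mean colouring ratio `E[F_{k,lam}(t)] / (lam * t^d)`. -/
noncomputable def meanColouringRatio {d : ℕ} {Ω : Type*} [MeasurableSpace Ω]
    (X : Ω → Set (EuclideanSpace ℝ (Fin d))) (P : Measure Ω) (k : ℕ) (lam t : ℝ) : ℝ :=
  ∫ ω, (poissonColoured X k t ω : ℝ) / (lam * t ^ d) ∂P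

/-- The constant `a_{k,lam} = inf_{t > 0} E[F_{k,lam}(t)] / (lam * t^d)`. -/
noncomputable def colouringConstant {d : ℕ} {Ω : Type*} [MeasurableSpace Ω]
    (X : Ω → Set (EuclideanSpace ℝ (Fin d))) (P : Measure Ω) (k : ℕ) (lam : ℝ) : ℝ :=
  ⨅ t : Set.Ioi (0 : ℝ), meanColouringRatio X P k lam t

/-!
Write `m(T)` for the expected number of colourable points of the Poisson process in `[0, T]^d`.
The number of colourable points is monotone and subadditive in the point set, so covering
`[0, T]^d` by translates of `[0, t]^d` gives `m(T) ≤ (⌊T/t⌋ + 1)^d m(t)`, and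
`m(T) / (ν T^d)` converges to its infimum `a` (`IsPoissonPointProcess.tendsto_meanColouringRatio`).

The comparison with independent uniform points goes through void probabilities. On a fine grid the
graph of a finite point set is determined by the set of occupied cells
(`eventually_maxColouredOn_gridCell_eq`), and the law of that set is determined by the
probabilities that given regions are void. Hence random finite sets with equal void probabilities
have the same expected number of colourable points (`integral_numColoured_eq_of_void_eq`); the same
discretisation provides measurability. This yields stationarity of the Poisson process, and allows
its restriction to `[0, T]^d` to be replaced by a Poisson number of dilated uniform points. Taking
`ν T^d = n` and scaling by `T⁻¹ = (ν / n)^(1/d)`, and because one more point changes the number of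
colourable points by at most one, the expectation for exactly `n` points differs from `m(T)` by at
most the mean absolute deviation of a Poisson variable of mean `n`, which is at most `√n`.

Finally, changing one of the `n` points changes the number of colourable points by at most one, so
McDiarmid's inequality (`hasSubgaussianMGF_of_bounded_differences`) bounds the probability of a
deviation of order `n` from the mean exponentially in `n`. These bounds are summable, and the
Borel–Cantelli lemma, which needs no independence between different `n`, gives almost sure
convergence.
-/

/-! ### Colourable subsets -/

/-- The sizes of the finite subsets of `V` on which some `k`-colouring of the ambient type is
proper for the relation `R`. -/
def colouredSizes {α : Type*} (k : ℕ) (R : α → α → Prop) (V : Set α) : Set ℕ :=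
  {m : ℕ | ∃ S : Finset α, (S : Set α) ⊆ V ∧ S.card = m ∧
    ∃ c : α → Fin k, ∀ x ∈ S, ∀ y ∈ S, x ≠ y → R x y → c x ≠ c y}

/-- The largest size of a finite subset of `V` on which some `k`-colouring of the ambient type is
proper for the relation `R`. Unlike `maxColoured` it lives on the ambient type, so that different
vertex sets can be compared without subtypes. It agrees with `maxColoured` for `1 ≤ k`. -/
noncomputable def maxColouredOn {α : Type*} (k : ℕ) (R : α → α → Prop) (V : Set α) : ℕ :=
  sSup (colouredSizes k R V)

section Combinatorics

variable {α β : Type*} {k : ℕ} {R : α → α → Prop} {V V₁ V₂ : Set α}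

theorem le_ncard_of_mem_colouredSizes (hV : V.Finite) {m : ℕ}
    (hm : m ∈ colouredSizes k R V) : m ≤ V.ncard := by
  obtain ⟨S, hS, rfl, -⟩ := hm
  rw [← Set.ncard_coe_finset]
  exact Set.ncard_le_ncard hS hV

theorem le_maxColouredOn (hV : V.Finite) {S : Finset α} (hS : (S : Set α) ⊆ V) {c : α → Fin k}
    (hc : ∀ x ∈ S, ∀ y ∈ S, x ≠ y → R x y → c x ≠ c y) : S.card ≤ maxColouredOn k R V :=
  le_csSup ⟨V.ncard, fun _ h => le_ncard_of_mem_colouredSizes hV h⟩ ⟨S, hS, rfl, c, hc⟩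

theorem exists_card_eq_maxColouredOn (hk : 1 ≤ k) (R : α → α → Prop) (hV : V.Finite) :
    ∃ S : Finset α, (S : Set α) ⊆ V ∧ S.card = maxColouredOn k R V ∧
      ∃ c : α → Fin k, ∀ x ∈ S, ∀ y ∈ S, x ≠ y → R x y → c x ≠ c y :=
  Nat.sSup_mem (s := colouredSizes k R V) ⟨0, ∅, by simp, rfl, fun _ => ⟨0, hk⟩, by simp⟩
    ⟨V.ncard, fun _ h => le_ncard_of_mem_colouredSizes hV h⟩

theorem maxColouredOn_le_ncard (hk : 1 ≤ k) (R : α → α → Prop) (hV : V.Finite) :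
    maxColouredOn k R V ≤ V.ncard := by
  obtain ⟨S, hS, h, c⟩ := exists_card_eq_maxColouredOn hk R hV
  exact le_ncard_of_mem_colouredSizes (k := k) (R := R) hV ⟨S, hS, h, c⟩

theorem maxColouredOn_mono (hk : 1 ≤ k) (hV : V₂.Finite) (h : V₁ ⊆ V₂) :
    maxColouredOn k R V₁ ≤ maxColouredOn k R V₂ := by
  obtain ⟨S, hS, hcard, c, hc⟩ := exists_card_eq_maxColouredOn hk R (hV.subset h)
  exact hcard ▸ le_maxColouredOn hV (hS.trans h) hc

open Classical in
theorem maxColouredOn_union_le (hk : 1 ≤ k) (h₁ : V₁.Finite) (h₂ : V₂.Finite) :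
    maxColouredOn k R (V₁ ∪ V₂) ≤ maxColouredOn k R V₁ + maxColouredOn k R V₂ := by
  obtain ⟨S, hS, hcard, c, hc⟩ := exists_card_eq_maxColouredOn hk R (h₁.union h₂)
  rw [← hcard, ← Finset.card_filter_add_card_filter_not (s := S) (· ∈ V₁)]
  refine add_le_add (le_maxColouredOn h₁ (c := c) ?_ ?_) (le_maxColouredOn h₂ (c := c) ?_ ?_)
  · intro x hx
    simp only [Finset.coe_filter, Set.mem_ofPred_eq] at hx
    exact hx.2
  · intro x hx y hy
    exact hc x (Finset.mem_filter.1 hx).1 y (Finset.mem_filter.1 hy).1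
  · intro x hx
    simp only [Finset.coe_filter, Set.mem_ofPred_eq] at hx
    exact (hS hx.1).resolve_left hx.2
  · intro x hx y hy
    exact hc x (Finset.mem_filter.1 hx).1 y (Finset.mem_filter.1 hy).1

theorem maxColouredOn_biUnion_le {ι : Type*} (hk : 1 ≤ k) (s : Finset ι) {U : ι → Set α}
    (hU : ∀ i, (U i).Finite) :
    maxColouredOn k R (⋃ i ∈ s, U i) ≤ ∑ i ∈ s, maxColouredOn k R (U i) := by
  classical
  induction s using Finset.induction_on with
  | empty => simpa using maxColouredOn_le_ncard hk R (Set.finite_empty (α := α))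
  | insert a s ha ih =>
    rw [Finset.set_biUnion_insert, Finset.sum_insert ha]
    exact (maxColouredOn_union_le hk (hU a) (s.finite_toSet.biUnion fun i _ => hU i)).trans
      (Nat.add_le_add_left ih _)

/-- `maxColouredOn` only depends on the isomorphism type of the graph which `R` induces
on `V`. -/
theorem maxColouredOn_image (hk : 1 ≤ k) {R' : β → β → Prop} {g : α → β}
    (hV : V.Finite) (hg : Set.InjOn g V)
    (hR : ∀ x ∈ V, ∀ y ∈ V, x ≠ y → (R x y ↔ R' (g x) (g y))) :
    maxColouredOn k R' (g '' V) = maxColouredOn k R V := by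
  classical
  apply le_antisymm
  · obtain ⟨S, hS, hcard, c, hc⟩ := exists_card_eq_maxColouredOn hk R' (hV.image g)
    obtain ⟨T, hTV, rfl⟩ := Finset.subset_set_image_iff.1 hS
    rw [← hcard, Finset.card_image_of_injOn (hg.mono hTV)]
    refine le_maxColouredOn hV hTV (c := c ∘ g) fun x hx y hy hxy hr => ?_
    exact hc _ (Finset.mem_image_of_mem g hx) _ (Finset.mem_image_of_mem g hy)
      (fun h => hxy (hg (hTV hx) (hTV hy) h)) ((hR x (hTV hx) y (hTV hy) hxy).1 hr)
  · obtain ⟨S, hS, hcard, c, hc⟩ := exists_card_eq_maxColouredOn hk R hV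
    rcases V.eq_empty_or_nonempty with rfl | ⟨v, -⟩
    · simp [Nat.le_zero.1 ((maxColouredOn_le_ncard hk R Set.finite_empty).trans_eq
        (Set.ncard_empty α))]
    have : Nonempty α := ⟨v⟩
    rw [← hcard, ← Finset.card_image_of_injOn (hg.mono hS)]
    have hinv : ∀ x ∈ V, Function.invFunOn g V (g x) = x := fun x hx => hg.leftInvOn_invFunOn hx
    refine le_maxColouredOn (hV.image g) (c := c ∘ Function.invFunOn g V) ?_ ?_
    · rw [Finset.coe_image]
      exact Set.image_mono hS
    · intro x hx y hy hxy hr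
      obtain ⟨x, hxS, rfl⟩ := Finset.mem_image.1 hx
      obtain ⟨y, hyS, rfl⟩ := Finset.mem_image.1 hy
      have hne : x ≠ y := fun h => hxy (h ▸ rfl)
      simp only [Function.comp_apply, hinv x (hS hxS), hinv y (hS hyS)]
      exact hc x hxS y hyS hne ((hR x (hS hxS) y (hS hyS) hne).2 hr)

end Combinatorics

theorem numColoured_eq_maxColouredOn {d k : ℕ} (hk : 1 ≤ k) (r : ℝ)
    (V : Set (EuclideanSpace ℝ (Fin d))) :
    numColoured k r V = maxColouredOn k (fun x y => dist x y ≤ r) V := by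
  classical
  rw [numColoured, maxColoured, maxColouredOn, colouredSizes]
  congr 1
  ext m
  constructor
  · rintro ⟨S, rfl, ⟨C⟩⟩
    refine ⟨S.map (Function.Embedding.subtype _), ?_, by simp, ?_⟩
    · intro x hx
      simp only [Finset.coe_map, Function.Embedding.subtype_apply, Set.mem_image] at hx
      obtain ⟨y, -, rfl⟩ := hx
      exact y.2
    · refine ⟨fun x => if h : ∃ hx : x ∈ V, (⟨x, hx⟩ : V) ∈ S then C ⟨⟨x, h.1⟩, h.2⟩
        else ⟨0, hk⟩, ?_⟩
      intro x hx y hy hxy hr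
      simp only [Finset.mem_map, Function.Embedding.subtype_apply] at hx hy
      obtain ⟨x, hx, rfl⟩ := hx
      obtain ⟨y, hy, rfl⟩ := hy
      have hx' : ∃ h : x.1 ∈ V, (⟨x.1, h⟩ : V) ∈ S := ⟨x.2, hx⟩
      have hy' : ∃ h : y.1 ∈ V, (⟨y.1, h⟩ : V) ∈ S := ⟨y.2, hy⟩
      beta_reduce
      rw [dif_pos hx', dif_pos hy']
      exact C.valid ⟨fun h => hxy (congrArg Subtype.val h), hr⟩
  · rintro ⟨S, hS, rfl, c, hc⟩
    have hSV : ∀ x ∈ S, x ∈ V := fun x hx => hS hx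
    refine ⟨S.subtype (· ∈ V), ?_, ⟨fun x => c x.1.1, ?_⟩⟩
    · rw [Finset.card_subtype, Finset.filter_true_of_mem hSV]
    · rintro ⟨x, hx⟩ ⟨y, hy⟩ h
      have h' : x ≠ y ∧ dist x y ≤ r := h
      exact hc x.1 (Finset.mem_subtype.1 hx) y.1 (Finset.mem_subtype.1 hy)
        (fun e => h'.1 (Subtype.ext e)) h'.2

section NumColoured

variable {d k : ℕ} {r : ℝ} {V V₁ V₂ : Set (EuclideanSpace ℝ (Fin d))}

theorem numColoured_le_ncard (hk : 1 ≤ k) (r : ℝ) (hV : V.Finite) :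
    numColoured k r V ≤ V.ncard := by
  rw [numColoured_eq_maxColouredOn hk]
  exact maxColouredOn_le_ncard hk _ hV

theorem numColoured_mono (hk : 1 ≤ k) (r : ℝ) (hV : V₂.Finite) (h : V₁ ⊆ V₂) :
    numColoured k r V₁ ≤ numColoured k r V₂ := by
  rw [numColoured_eq_maxColouredOn hk, numColoured_eq_maxColouredOn hk]
  exact maxColouredOn_mono hk hV h

theorem numColoured_le_add_ncard (hk : 1 ≤ k) (r : ℝ) {V' D : Set (EuclideanSpace ℝ (Fin d))}
    (hV : V'.Finite) (hD : D.Finite) (h : V ⊆ V' ∪ D) :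
    numColoured k r V ≤ numColoured k r V' + D.ncard := by
  refine (numColoured_mono hk r (hV.union hD) h).trans ?_
  rw [numColoured_eq_maxColouredOn hk, numColoured_eq_maxColouredOn hk]
  exact (maxColouredOn_union_le hk hV hD).trans
    (Nat.add_le_add_left (maxColouredOn_le_ncard hk _ hD) _)

theorem numColoured_biUnion_le {ι : Type*} (hk : 1 ≤ k) (r : ℝ) (s : Finset ι)
    {U : ι → Set (EuclideanSpace ℝ (Fin d))} (hU : ∀ i, (U i).Finite) (h : V ⊆ ⋃ i ∈ s, U i) :
    numColoured k r V ≤ ∑ i ∈ s, numColoured k r (U i) := by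
  refine (numColoured_mono hk r (s.finite_toSet.biUnion fun i _ => hU i) h).trans ?_
  simp only [numColoured_eq_maxColouredOn hk]
  exact maxColouredOn_biUnion_le hk s hU

theorem numColoured_image {r' : ℝ} (hk : 1 ≤ k)
    {g : EuclideanSpace ℝ (Fin d) → EuclideanSpace ℝ (Fin d)} (hV : V.Finite) (hg : Set.InjOn g V)
    (hd : ∀ x ∈ V, ∀ y ∈ V, dist x y ≤ r ↔ dist (g x) (g y) ≤ r') :
    numColoured k r' (g '' V) = numColoured k r V := by
  rw [numColoured_eq_maxColouredOn hk, numColoured_eq_maxColouredOn hk]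
  exact maxColouredOn_image hk hV hg fun x hx y hy _ => hd x hx y hy

end NumColoured

/-! ### Discretisation of random finite sets -/

/-- The index of the cell of the grid of mesh `1 / M` that contains `x`. -/
noncomputable def gridCell {d : ℕ} (M : ℕ) (x : EuclideanSpace ℝ (Fin d)) : Fin d → ℤ :=
  fun i => ⌊(M : ℝ) * x i⌋

theorem measurable_gridCell {d : ℕ} (M : ℕ) : Measurable (gridCell (d := d) M) :=
  measurable_pi_lambda _ fun i => Int.measurable_floor.comp (by fun_prop)

theorem exists_dist_le_div_of_gridCell_eq (d : ℕ) : ∃ C : ℝ, ∀ M : ℕ, 1 ≤ M →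
    ∀ x y : EuclideanSpace ℝ (Fin d), gridCell M x = gridCell M y → dist x y ≤ C / M := by
  obtain ⟨C, hC⟩ : ∃ C, AntilipschitzWith C (@WithLp.ofLp 2 (Fin d → ℝ)) :=
    ⟨_, PiLp.antilipschitzWith_ofLp 2 (fun _ : Fin d => ℝ)⟩
  refine ⟨C, fun M hM x y h => (hC.le_mul_dist x y).trans ?_⟩
  rw [div_eq_mul_one_div]
  refine mul_le_mul_of_nonneg_left ?_ (NNReal.coe_nonneg _)
  have hM' : (0 : ℝ) < M := by exact_mod_cast hM
  refine (dist_pi_le_iff (by positivity)).2 fun i => ?_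
  have h1 := Int.abs_sub_lt_one_of_floor_eq_floor (congrFun h i)
  rw [← mul_sub, abs_mul, abs_of_pos hM'] at h1
  rw [Real.dist_eq, le_div_iff₀ hM', mul_comm]
  exact h1.le

/-- Two cells are in conflict if they contain points at distance at most `r`. -/
def CellConflict {d : ℕ} (M : ℕ) (r : ℝ) (i j : Fin d → ℤ) : Prop :=
  ∃ x y : EuclideanSpace ℝ (Fin d), gridCell M x = i ∧ gridCell M y = j ∧ dist x y ≤ r

/-- On a finite set of points, a sufficiently fine grid separates the points and its cells are in
conflict exactly when the points are adjacent: non-adjacency `r < dist x y` is an open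
condition. -/
theorem eventually_maxColouredOn_gridCell_eq {d k : ℕ} (hk : 1 ≤ k) (r : ℝ)
    {V : Set (EuclideanSpace ℝ (Fin d))} (hV : V.Finite) :
    ∀ᶠ M : ℕ in atTop,
      maxColouredOn k (CellConflict M r) (gridCell M '' V) = numColoured k r V := by
  obtain ⟨C, hC⟩ := exists_dist_le_div_of_gridCell_eq d
  have hlim : Tendsto (fun M : ℕ => C / (M : ℝ)) atTop (𝓝 0) :=
    tendsto_const_div_atTop_nhds_zero_nat C
  have hlim2 : Tendsto (fun M : ℕ => C / (M : ℝ) + C / (M : ℝ)) atTop (𝓝 0) := by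
    simpa using hlim.add hlim
  have hinj : ∀ᶠ M : ℕ in atTop, ∀ x ∈ V, ∀ y ∈ V, gridCell M x = gridCell M y → x = y := by
    rw [eventually_all_finite hV]
    intro x _
    rw [eventually_all_finite hV]
    intro y _
    by_cases hxy : x = y
    · exact Eventually.of_forall fun _ _ => hxy
    filter_upwards [hlim.eventually_lt_const (dist_pos.2 hxy), eventually_ge_atTop 1]
      with M hM hM1 h
    exact absurd (hC M hM1 x y h) (not_le.2 hM)
  have hconf : ∀ᶠ M : ℕ in atTop, ∀ x ∈ V, ∀ y ∈ V,
      CellConflict M r (gridCell M x) (gridCell M y) → dist x y ≤ r := by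
    rw [eventually_all_finite hV]
    intro x _
    rw [eventually_all_finite hV]
    intro y _
    by_cases hxy : dist x y ≤ r
    · exact Eventually.of_forall fun _ _ => hxy
    filter_upwards [hlim2.eventually_lt_const (sub_pos.2 (not_le.1 hxy)), eventually_ge_atTop 1]
      with M hM hM1 ⟨x', y', hx', hy', h⟩
    have h1 := hC M hM1 x' x hx'
    have h2 := hC M hM1 y' y hy'
    have h3 := dist_triangle4 x x' y' y
    rw [dist_comm x x'] at h3
    linarith
  filter_upwards [hinj, hconf] with M h1 h2
  rw [numColoured_eq_maxColouredOn hk]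
  refine maxColouredOn_image hk hV (fun x hx y hy h => h1 x hx y hy h) fun x hx y hy _ => ?_
  exact ⟨fun h => ⟨x, y, rfl, rfl, h⟩, h2 x hx y hy⟩

/-- Finite sets of cells carry the discrete `σ`-algebra. -/
instance finsetCellMeasurableSpace (d : ℕ) : MeasurableSpace (Finset (Fin d → ℤ)) := ⊤

instance (d : ℕ) : DiscreteMeasurableSpace (Finset (Fin d → ℤ)) := ⟨fun _ => trivial⟩

/-- The down-sets `{W | W ⊆ A}` of finite sets of cells generate the discrete `σ`-algebra, since
they yield the singletons and there are only countably many finite sets. -/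
theorem generateFrom_range_Iic_finset (d : ℕ) :
    finsetCellMeasurableSpace d =
      MeasurableSpace.generateFrom (Set.range Set.Iic) := by
  classical
  apply le_antisymm _ le_top
  intro s _
  have hIic : ∀ A : Finset (Fin d → ℤ),
      MeasurableSet[MeasurableSpace.generateFrom (Set.range Set.Iic)] (Set.Iic A) :=
    fun A => MeasurableSpace.measurableSet_generateFrom ⟨A, rfl⟩
  have hsing : ∀ A : Finset (Fin d → ℤ),
      MeasurableSet[MeasurableSpace.generateFrom (Set.range Set.Iic)] {A} := by
    intro A
    have : ({A} : Set (Finset (Fin d → ℤ))) = Set.Iic A \ ⋃ B ∈ A.ssubsets, Set.Iic B := by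
      ext D
      simp only [Set.mem_singleton_iff, Set.mem_sdiff, Set.mem_Iic, Set.mem_iUnion,
        Finset.mem_ssubsets, not_exists]
      constructor
      · rintro rfl
        exact ⟨subset_rfl, fun B hB h => hB.2 h⟩
      · rintro ⟨h1, h2⟩
        by_contra hne
        exact h2 D (Finset.ssubset_iff_subset_ne.2 ⟨h1, hne⟩) subset_rfl
    rw [this]
    exact (hIic A).diff (A.ssubsets.measurableSet_biUnion fun B _ => hIic B)
  rw [← Set.biUnion_of_singleton s]
  exact MeasurableSet.biUnion s.to_countable fun A _ => hsing A

section RandomSets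

variable {d : ℕ} {Ω : Type*} {Y : Ω → Set (EuclideanSpace ℝ (Fin d))}

/-- The finite set of grid cells of mesh `1 / M` occupied by the random finite set `Y`. -/
noncomputable def occupiedCells (hY : ∀ ω, (Y ω).Finite) (M : ℕ) (ω : Ω) : Finset (Fin d → ℤ) :=
  ((hY ω).image (gridCell M)).toFinset

theorem occupiedCells_preimage_Iic (hY : ∀ ω, (Y ω).Finite) (M : ℕ) (A : Finset (Fin d → ℤ)) :
    occupiedCells hY M ⁻¹' Set.Iic A = {ω | Y ω ∩ gridCell M ⁻¹' (A : Set (Fin d → ℤ))ᶜ = ∅} := by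
  ext ω
  simp only [occupiedCells, Set.mem_preimage, Set.mem_Iic,
    Set.Finite.toFinset_subset, Set.image_subset_iff, Set.preimage_compl, Set.mem_ofPred_eq]
  rw [← Set.sdiff_eq, Set.sdiff_eq_empty]

theorem measurableSet_gridCell_preimage (M : ℕ) (A : Set (Fin d → ℤ)) :
    MeasurableSet (gridCell M ⁻¹' A) :=
  measurable_gridCell M A.to_countable.measurableSet

theorem tendsto_maxColouredOn_occupiedCells {k : ℕ} (hk : 1 ≤ k) (r : ℝ)
    (hY : ∀ ω, (Y ω).Finite) (ω : Ω) :
    Tendsto (fun M : ℕ => (maxColouredOn k (CellConflict M r)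
      (occupiedCells hY M ω : Set (Fin d → ℤ)) : ℝ)) atTop (𝓝 (numColoured k r (Y ω) : ℝ)) := by
  refine tendsto_const_nhds.congr' ?_
  filter_upwards [eventually_maxColouredOn_gridCell_eq hk r (hY ω)] with M hM
  rw [occupiedCells, Set.Finite.coe_toFinset, hM]

variable [MeasurableSpace Ω]

theorem measurable_occupiedCells (hY : ∀ ω, (Y ω).Finite)
    (hvoid : ∀ B, MeasurableSet B → MeasurableSet {ω | Y ω ∩ B = ∅}) (M : ℕ) :
    Measurable (occupiedCells hY M) := by
  rw [generateFrom_range_Iic_finset]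
  apply measurable_generateFrom
  rintro _ ⟨A, rfl⟩
  rw [occupiedCells_preimage_Iic]
  exact hvoid _ (measurableSet_gridCell_preimage M _)

theorem aemeasurable_occupiedCells {P : Measure Ω} (hY : ∀ ω, (Y ω).Finite)
    (hvoid : ∀ B, MeasurableSet B → NullMeasurableSet {ω | Y ω ∩ B = ∅} P) (M : ℕ) :
    AEMeasurable (occupiedCells hY M) P := by
  have h : NullMeasurable (occupiedCells hY M) P :=
    measurable_occupiedCells (Ω := NullMeasurableSpace Ω P) hY hvoid M
  exact h.aemeasurable

theorem measurable_numColoured {k : ℕ} (hk : 1 ≤ k) (r : ℝ) (hY : ∀ ω, (Y ω).Finite)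
    (hvoid : ∀ B, MeasurableSet B → MeasurableSet {ω | Y ω ∩ B = ∅}) :
    Measurable fun ω => (numColoured k r (Y ω) : ℝ) :=
  measurable_of_tendsto_metrizable
    (fun M => (Measurable.of_discrete (f := fun W : Finset (Fin d → ℤ) =>
      (maxColouredOn k (CellConflict M r) (W : Set (Fin d → ℤ)) : ℝ))).comp
        (measurable_occupiedCells hY hvoid M))
    (tendsto_pi_nhds.2 fun ω => tendsto_maxColouredOn_occupiedCells hk r hY ω)

theorem aemeasurable_numColoured {P : Measure Ω} {k : ℕ} (hk : 1 ≤ k) (r : ℝ)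
    (hY : ∀ ω, (Y ω).Finite)
    (hvoid : ∀ B, MeasurableSet B → NullMeasurableSet {ω | Y ω ∩ B = ∅} P) :
    AEMeasurable (fun ω => (numColoured k r (Y ω) : ℝ)) P := by
  have h : NullMeasurable (fun ω => (numColoured k r (Y ω) : ℝ)) P :=
    measurable_numColoured (Ω := NullMeasurableSpace Ω P) hk r hY hvoid
  exact h.aemeasurable

theorem tendsto_integral_maxColouredOn_occupiedCells {P : Measure Ω} {k : ℕ} (hk : 1 ≤ k) (r : ℝ)
    (hY : ∀ ω, (Y ω).Finite)
    (hvoid : ∀ B, MeasurableSet B → NullMeasurableSet {ω | Y ω ∩ B = ∅} P)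
    {g : Ω → ℝ} (hg : Integrable g P) (hYg : ∀ ω, ((Y ω).ncard : ℝ) ≤ g ω) :
    Tendsto (fun M : ℕ => ∫ W, (maxColouredOn k (CellConflict M r) (W : Set (Fin d → ℤ)) : ℝ)
      ∂(P.map (occupiedCells hY M))) atTop (𝓝 (∫ ω, (numColoured k r (Y ω) : ℝ) ∂P)) := by
  have hmap : ∀ M, ∫ W, (maxColouredOn k (CellConflict M r) (W : Set (Fin d → ℤ)) : ℝ)
      ∂(P.map (occupiedCells hY M)) = ∫ ω, (maxColouredOn k (CellConflict M r)
        (occupiedCells hY M ω : Set (Fin d → ℤ)) : ℝ) ∂P := fun M =>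
    integral_map (aemeasurable_occupiedCells hY hvoid M)
      (Measurable.of_discrete.aestronglyMeasurable)
  simp only [hmap]
  refine tendsto_integral_of_dominated_convergence g (fun M => ?_) hg (fun M => ?_) ?_
  · exact ((Measurable.of_discrete (f := fun W : Finset (Fin d → ℤ) =>
      (maxColouredOn k (CellConflict M r) (W : Set (Fin d → ℤ)) : ℝ))).comp_aemeasurable
        (aemeasurable_occupiedCells hY hvoid M)).aestronglyMeasurable
  · refine Eventually.of_forall fun ω => ?_
    rw [Real.norm_natCast]
    refine le_trans ?_ (hYg ω)
    rw [occupiedCells, Set.Finite.coe_toFinset, Nat.cast_le]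
    exact (maxColouredOn_le_ncard hk _ ((hY ω).image _)).trans (Set.ncard_image_le (hY ω))
  · exact Eventually.of_forall fun ω => tendsto_maxColouredOn_occupiedCells hk r hY ω

/-- A form of Rényi's theorem: two random finite sets with the same void probabilities have the
same law of occupied grid cells (the events "all occupied cells lie in `A`" form a generating
`π`-system), hence the same expected number of colourable points. -/
theorem integral_numColoured_eq_of_void_eq {Ω' : Type*} [MeasurableSpace Ω'] {P : Measure Ω}
    {P' : Measure Ω'} [IsProbabilityMeasure P] [IsProbabilityMeasure P'] {k : ℕ} (hk : 1 ≤ k)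
    (r : ℝ) {Y' : Ω' → Set (EuclideanSpace ℝ (Fin d))}
    (hY : ∀ ω, (Y ω).Finite) (hY' : ∀ ω, (Y' ω).Finite)
    (hvoid : ∀ B, MeasurableSet B → NullMeasurableSet {ω | Y ω ∩ B = ∅} P)
    (hvoid' : ∀ B, MeasurableSet B → NullMeasurableSet {ω | Y' ω ∩ B = ∅} P')
    {g : Ω → ℝ} (hg : Integrable g P) (hYg : ∀ ω, ((Y ω).ncard : ℝ) ≤ g ω)
    {g' : Ω' → ℝ} (hg' : Integrable g' P') (hYg' : ∀ ω, ((Y' ω).ncard : ℝ) ≤ g' ω)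
    (heq : ∀ B, MeasurableSet B → P {ω | Y ω ∩ B = ∅} = P' {ω | Y' ω ∩ B = ∅}) :
    ∫ ω, (numColoured k r (Y ω) : ℝ) ∂P = ∫ ω, (numColoured k r (Y' ω) : ℝ) ∂P' := by
  refine tendsto_nhds_unique
    (tendsto_integral_maxColouredOn_occupiedCells hk r hY hvoid hg hYg) ?_
  have hlaw : ∀ M, P.map (occupiedCells hY M) = P'.map (occupiedCells hY' M) := by
    intro M
    have hm := aemeasurable_occupiedCells hY hvoid M
    have hm' := aemeasurable_occupiedCells hY' hvoid' M
    have := Measure.isProbabilityMeasure_map hm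
    have := Measure.isProbabilityMeasure_map hm'
    refine ext_of_generate_finite _ (generateFrom_range_Iic_finset d) ?_ ?_ (by simp)
    · classical
      rintro _ ⟨A, rfl⟩ _ ⟨B, rfl⟩ -
      exact ⟨A ⊓ B, Set.Iic_inter_Iic.symm⟩
    · rintro _ ⟨A, rfl⟩
      rw [Measure.map_apply_of_aemeasurable hm .of_discrete,
        Measure.map_apply_of_aemeasurable hm' .of_discrete, occupiedCells_preimage_Iic,
        occupiedCells_preimage_Iic]
      exact heq _ (measurableSet_gridCell_preimage M _)
  simp only [hlaw]
  exact tendsto_integral_maxColouredOn_occupiedCells hk r hY' hvoid' hg' hYg'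

end RandomSets

/-! ### Poisson moments and cubes -/

section PoissonMoments

open scoped NNReal Nat

/-- The identity `E[N f(N - 1)] = r E[f(N)]` for a Poisson variable `N` of mean `r`. -/
theorem hasSum_poisson_mul_shift (r : ℝ≥0) {f : ℕ → ℝ} {s : ℝ}
    (h : HasSum (fun n => Real.exp (-r) * r ^ n / n ! * f n) s) :
    HasSum (fun n : ℕ => Real.exp (-r) * r ^ n / n ! * (n * f (n - 1))) (r * s) := by
  rw [← hasSum_nat_add_iff' 1]
  simp only [Finset.range_one, Finset.sum_singleton, Nat.cast_zero, zero_mul, mul_zero, sub_zero,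
    Nat.add_sub_cancel]
  refine (h.mul_left (r : ℝ)).congr_fun fun n => ?_
  rw [Nat.factorial_succ]
  push_cast
  field_simp
  ring

theorem hasSum_poisson_id (r : ℝ≥0) :
    HasSum (fun n : ℕ => Real.exp (-r) * r ^ n / n ! * (n : ℝ)) r := by
  have h : HasSum (fun n : ℕ => Real.exp (-r) * r ^ n / n ! * (1 : ℝ)) 1 := by
    simpa using hasSum_one_poissonMeasure r
  simpa using hasSum_poisson_mul_shift r h

/-- The variance of a Poisson variable of mean `r` is `r`. -/
theorem hasSum_poisson_sq_sub (r : ℝ≥0) :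
    HasSum (fun n : ℕ => Real.exp (-r) * r ^ n / n ! * ((n : ℝ) - r) ^ 2) r := by
  have h2 := hasSum_poisson_mul_shift r (hasSum_poisson_id r)
  have h1 := (hasSum_poisson_id r).mul_left (1 - 2 * (r : ℝ))
  have h0 := (hasSum_one_poissonMeasure r).mul_left ((r : ℝ) ^ 2)
  have h := (h2.add h1).add h0
  have e : (r : ℝ) * r + (1 - 2 * r) * r + r ^ 2 * 1 = r := by ring
  rw [e] at h
  refine h.congr_fun fun n => ?_
  rcases n with _ | n
  · simp; ring
  · simp only [Nat.add_sub_cancel]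
    push_cast
    ring

theorem integrable_natCast_poissonMeasure (r : ℝ≥0) :
    Integrable (fun n : ℕ => (n : ℝ)) (poissonMeasure r) := by
  rw [integrable_poissonMeasure_iff]
  simpa using (hasSum_poisson_id r).summable

/-- The mean absolute deviation of a Poisson variable is at most its standard deviation. -/
theorem integral_abs_sub_poissonMeasure_le {r : ℝ≥0} (hr : 0 < r) :
    ∫ n : ℕ, |(n : ℝ) - r| ∂(poissonMeasure r) ≤ √r := by
  have hs : 0 < √(r : ℝ) := Real.sqrt_pos.2 hr
  have hsq : √(r : ℝ) * √(r : ℝ) = r := Real.mul_self_sqrt r.2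
  have hint2 : Integrable (fun n : ℕ => ((n : ℝ) - r) ^ 2) (poissonMeasure r) := by
    rw [integrable_poissonMeasure_iff]
    simpa using (hasSum_poisson_sq_sub r).summable
  have hint1 : Integrable (fun n : ℕ => |(n : ℝ) - r|) (poissonMeasure r) :=
    ((integrable_natCast_poissonMeasure r).sub (integrable_const _)).abs
  have hval : ∫ n : ℕ, ((n : ℝ) - r) ^ 2 ∂(poissonMeasure r) = r := by
    rw [integral_poissonMeasure]
    exact (hasSum_poisson_sq_sub r).tsum_eq
  -- AM-GM with weight `√r` turns the second moment into a bound for the first without Jensen.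
  have key : ∀ n : ℕ, |(n : ℝ) - r| ≤ (2 * √(r : ℝ))⁻¹ * ((n : ℝ) - r) ^ 2 + √(r : ℝ) / 2 := by
    intro n
    rw [← sq_abs ((n : ℝ) - r)]
    set u := |(n : ℝ) - r|
    have : (2 * √(r : ℝ))⁻¹ * u ^ 2 + √(r : ℝ) / 2 - u
        = (2 * √(r : ℝ))⁻¹ * (u - √(r : ℝ)) ^ 2 := by
      field_simp
      ring
    have h2 : 0 ≤ (2 * √(r : ℝ))⁻¹ * (u - √(r : ℝ)) ^ 2 := by positivity
    linarith
  refine (integral_mono hint1 ((hint2.const_mul _).add (integrable_const _)) key).trans ?_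
  rw [integral_add' (hint2.const_mul _) (integrable_const _), integral_const_mul, hval,
    integral_const]
  simp only [probReal_univ, smul_eq_mul, one_mul]
  have : (2 * √(r : ℝ))⁻¹ * r = √(r : ℝ) / 2 := by
    nth_rw 2 [← hsq]
    field_simp
  linarith

/-- The probability generating function of the Poisson distribution. -/
theorem lintegral_pow_poissonMeasure (r : ℝ≥0) {q : ℝ} (hq : 0 ≤ q) :
    ∫⁻ n : ℕ, ENNReal.ofReal q ^ n ∂(poissonMeasure r) =
      ENNReal.ofReal (Real.exp (r * (q - 1))) := by
  have hs : HasSum (fun n : ℕ => Real.exp (-r) * r ^ n / n ! * q ^ n)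
      (Real.exp (r * (q - 1))) := by
    have h := (NormedSpace.expSeries_div_hasSum_exp ((r : ℝ) * q)).mul_left (Real.exp (-r))
    rw [← Real.exp_eq_exp_ℝ, ← Real.exp_add] at h
    have e : -(r : ℝ) + r * q = r * (q - 1) := by ring
    rw [e] at h
    refine h.congr_fun fun n => ?_
    rw [mul_pow]
    ring
  rw [lintegral_countable', ← hs.tsum_eq,
    ENNReal.ofReal_tsum_of_nonneg (fun n => by positivity) hs.summable]
  congr 1 with n
  rw [poissonMeasure_singleton, ← ENNReal.ofReal_pow hq, ← ENNReal.ofReal_mul (by positivity),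
    mul_comm]

end PoissonMoments

section Cube

variable {d : ℕ}

theorem measurableSet_cube (d : ℕ) (t : ℝ) : MeasurableSet (cube d t) := by
  have : cube d t = ⋂ i, (fun x : EuclideanSpace ℝ (Fin d) => x i) ⁻¹' Set.Icc 0 t := by
    ext x; simp [cube]
  rw [this]
  exact MeasurableSet.iInter fun i => measurableSet_Icc.preimage (by fun_prop)

theorem cube_eq_preimage (d : ℕ) (t : ℝ) :
    cube d t = (@WithLp.ofLp 2 (Fin d → ℝ)) ⁻¹' Set.Icc 0 (fun _ => t) := by
  ext x
  simp [cube, Pi.le_def, forall_and]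

theorem volume_cube (d : ℕ) {t : ℝ} (ht : 0 ≤ t) :
    volume (cube d t) = ENNReal.ofReal (t ^ d) := by
  rw [cube_eq_preimage, (PiLp.volume_preserving_ofLp (Fin d)).measure_preimage
    measurableSet_Icc.nullMeasurableSet, Real.volume_Icc_pi]
  simp [ENNReal.ofReal_pow ht]

theorem isBounded_cube (d : ℕ) (t : ℝ) : Bornology.IsBounded (cube d t) := by
  rw [cube_eq_preimage]
  exact (PiLp.antilipschitzWith_ofLp 2 (fun _ : Fin d => ℝ)).isBounded_preimage
    (Metric.isBounded_Icc _ _)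

/-- The uniform distribution on the unit cube. -/
noncomputable def uniformCube (d : ℕ) : Measure (EuclideanSpace ℝ (Fin d)) :=
  volume.restrict (cube d 1)

instance (d : ℕ) : IsProbabilityMeasure (uniformCube d) :=
  ⟨by rw [uniformCube, Measure.restrict_apply_univ, volume_cube d zero_le_one]; simp⟩

theorem cond_volume_cube (d : ℕ) :
    ProbabilityTheory.cond volume (cube d 1) = uniformCube d := by
  rw [ProbabilityTheory.cond, volume_cube d zero_le_one, uniformCube]
  simp

theorem uniformCube_preimage_smul {T : ℝ} (hT : 0 < T) (B : Set (EuclideanSpace ℝ (Fin d)))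
    (hB : MeasurableSet B) :
    (uniformCube d).real ((fun x => T • x) ⁻¹' B) = volume.real (cube d T ∩ B) / T ^ d := by
  have hpre : (fun x : EuclideanSpace ℝ (Fin d) => T • x) ⁻¹' B ∩ cube d 1
      = (fun x => T • x) ⁻¹' (cube d T ∩ B) := by
    ext x
    simp only [cube, Set.mem_inter_iff, Set.mem_preimage, Set.mem_ofPred_eq, Set.mem_Icc,
      PiLp.smul_apply, smul_eq_mul, mul_nonneg_iff_of_pos_left hT, mul_le_iff_le_one_right hT]
    exact and_comm
  rw [uniformCube, measureReal_restrict_apply (hB.preimage (by fun_prop)), hpre, measureReal_def,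
    Measure.addHaar_preimage_smul _ hT.ne', ENNReal.toReal_mul, measureReal_def]
  simp only [finrank_euclideanSpace, Fintype.card_fin]
  rw [ENNReal.toReal_ofReal (abs_nonneg _), abs_of_pos (by positivity)]
  field_simp

end Cube

/-! ### Poisson processes and uniform samples -/

section PoissonProcess

variable {d : ℕ} {Ω : Type*} [MeasurableSpace Ω] {P : Measure Ω}
  {X : Ω → Set (EuclideanSpace ℝ (Fin d))} {lam : ℝ} {B : Set (EuclideanSpace ℝ (Fin d))}

theorem IsPoissonPointProcess.setOf_inter_eq_empty (hX : IsPoissonPointProcess lam X P)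
    (hb : Bornology.IsBounded B) :
    {ω | X ω ∩ B = ∅} = (fun ω => (X ω ∩ B).ncard) ⁻¹' {0} := by
  ext ω
  simp [Set.ncard_eq_zero (hX.locallyFinite ω B hb)]

theorem IsPoissonPointProcess.nullMeasurableSet_void (hX : IsPoissonPointProcess lam X P)
    (hB : MeasurableSet B) (hb : Bornology.IsBounded B) :
    NullMeasurableSet {ω | X ω ∩ B = ∅} P := by
  rw [hX.setOf_inter_eq_empty hb]
  exact (hX.hasLaw_count B hB hb).aemeasurable.nullMeasurable (measurableSet_singleton 0)

theorem IsPoissonPointProcess.measure_void (hX : IsPoissonPointProcess lam X P) (hlam : 0 ≤ lam)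
    (hB : MeasurableSet B) (hb : Bornology.IsBounded B) :
    P {ω | X ω ∩ B = ∅} = ENNReal.ofReal (Real.exp (-(lam * volume.real B))) := by
  have h := hX.hasLaw_count B hB hb
  rw [hX.setOf_inter_eq_empty hb,
    ← Measure.map_apply_of_aemeasurable h.aemeasurable (measurableSet_singleton 0), h.map_eq,
    poissonMeasure_singleton, Real.coe_toNNReal _ (mul_nonneg hlam measureReal_nonneg)]
  simp

theorem IsPoissonPointProcess.integrable_ncard (hX : IsPoissonPointProcess lam X P)
    (hB : MeasurableSet B) (hb : Bornology.IsBounded B) :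
    Integrable (fun ω => ((X ω ∩ B).ncard : ℝ)) P := by
  have h := hX.hasLaw_count B hB hb
  have hint := integrable_natCast_poissonMeasure (lam * volume.real B).toNNReal
  rw [← h.map_eq] at hint
  exact hint.comp_aemeasurable h.aemeasurable

theorem IsPoissonPointProcess.integrable_numColoured {k : ℕ} (hk : 1 ≤ k) (r : ℝ)
    (hX : IsPoissonPointProcess lam X P) (hB : MeasurableSet B) (hb : Bornology.IsBounded B) :
    Integrable (fun ω => (numColoured k r (X ω ∩ B) : ℝ)) P := by
  have hfin := fun ω => hX.locallyFinite ω B hb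
  refine (hX.integrable_ncard hB hb).mono' (aemeasurable_numColoured hk r hfin
    fun A hA => ?_).aestronglyMeasurable (Eventually.of_forall fun ω => ?_)
  · simp only [Set.inter_assoc]
    exact hX.nullMeasurableSet_void (hB.inter hA) (hb.subset Set.inter_subset_left)
  · rw [Real.norm_natCast, Nat.cast_le]
    exact numColoured_le_ncard hk r (hfin ω)

/-- Stationarity: the expected number of colourable points in a translate of a cube. -/
theorem IsPoissonPointProcess.integral_numColoured_translate [IsProbabilityMeasure P] {k : ℕ}
    (hk : 1 ≤ k) (r : ℝ) (hX : IsPoissonPointProcess lam X P) (hlam : 0 ≤ lam)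
    (hB : MeasurableSet B) (hb : Bornology.IsBounded B) (v : EuclideanSpace ℝ (Fin d)) :
    ∫ ω, (numColoured k r (X ω ∩ (fun x => x - v) ⁻¹' B) : ℝ) ∂P
      = ∫ ω, (numColoured k r (X ω ∩ B) : ℝ) ∂P := by
  have hpre : ∀ A : Set (EuclideanSpace ℝ (Fin d)), Bornology.IsBounded A →
      Bornology.IsBounded ((fun x => x - v) ⁻¹' A) := fun A hA =>
    (AntilipschitzWith.of_le_mul_dist (K := 1) fun x y => by simp).isBounded_preimage hA
  have hmeas : Measurable fun x : EuclideanSpace ℝ (Fin d) => x - v := by fun_prop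
  have hfin := fun ω => hX.locallyFinite ω _ (hpre B hb)
  have himg : ∀ ω, numColoured k r (X ω ∩ (fun x => x - v) ⁻¹' B)
      = numColoured k r ((fun x => x - v) '' (X ω ∩ (fun x => x - v) ⁻¹' B)) := fun ω =>
    (numColoured_image hk (hfin ω) (fun x _ y _ h => sub_left_injective h)
      fun x _ y _ => by rw [dist_sub_right]).symm
  have hev : ∀ A : Set (EuclideanSpace ℝ (Fin d)),
      {ω | (fun x => x - v) '' (X ω ∩ (fun x => x - v) ⁻¹' B) ∩ A = ∅}
        = {ω | X ω ∩ (fun x => x - v) ⁻¹' (B ∩ A) = ∅} := by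
    intro A
    ext ω
    rw [Set.mem_ofPred_eq, Set.mem_ofPred_eq, ← Set.image_inter_preimage, Set.image_eq_empty,
      Set.preimage_inter, Set.inter_assoc]
  simp only [himg]
  refine integral_numColoured_eq_of_void_eq hk r (fun ω => (hfin ω).image _)
    (fun ω => hX.locallyFinite ω B hb) (fun A hA => ?_) (fun A hA => ?_)
    (hX.integrable_ncard (hB.preimage hmeas) (hpre B hb))
    (fun ω => Nat.cast_le.2 (Set.ncard_image_le (hfin ω)))
    (hX.integrable_ncard hB hb) (fun ω => le_rfl) fun A hA => ?_
  · rw [hev]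
    exact hX.nullMeasurableSet_void ((hB.inter hA).preimage hmeas)
      (hpre _ (hb.subset Set.inter_subset_left))
  · simp only [Set.inter_assoc]
    exact hX.nullMeasurableSet_void (hB.inter hA) (hb.subset Set.inter_subset_left)
  · rw [hev]
    simp only [Set.inter_assoc]
    rw [hX.measure_void hlam ((hB.inter hA).preimage hmeas)
      (hpre _ (hb.subset Set.inter_subset_left)),
      hX.measure_void hlam (hB.inter hA) (hb.subset Set.inter_subset_left)]
    simp only [sub_eq_add_neg, measureReal_def, measure_preimage_add_right]

end PoissonProcess

section Sampling

variable {d : ℕ}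

/-- The first `p.1` points of the sequence `p.2`, dilated by `T`. When `p.1` is Poisson distributed
and the points are independent and uniform in the unit cube, this is a Poisson process on
`[0, T]^d`. -/
def dilatedSample (T : ℝ) (p : ℕ × (ℕ → EuclideanSpace ℝ (Fin d))) :
    Set (EuclideanSpace ℝ (Fin d)) :=
  (fun i => T • p.2 i) '' Set.Iio p.1

theorem finite_dilatedSample (T : ℝ) (p : ℕ × (ℕ → EuclideanSpace ℝ (Fin d))) :
    (dilatedSample T p).Finite := (Set.finite_Iio p.1).image _

theorem ncard_dilatedSample_le (T : ℝ) (p : ℕ × (ℕ → EuclideanSpace ℝ (Fin d))) :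
    (dilatedSample T p).ncard ≤ p.1 := by
  refine (Set.ncard_image_le (Set.finite_Iio p.1)).trans ?_
  simp [Set.ncard_eq_toFinset_card']

theorem dilatedSample_inter_eq_empty_iff {T : ℝ} {p : ℕ × (ℕ → EuclideanSpace ℝ (Fin d))}
    {B : Set (EuclideanSpace ℝ (Fin d))} :
    dilatedSample T p ∩ B = ∅ ↔ ∀ i < p.1, p.2 i ∈ (fun x => T • x) ⁻¹' Bᶜ := by
  rw [dilatedSample, ← Set.image_inter_preimage, Set.image_eq_empty,
    Set.eq_empty_iff_forall_notMem]
  simp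

theorem measurableSet_dilatedSample_void (T : ℝ) {B : Set (EuclideanSpace ℝ (Fin d))}
    (hB : MeasurableSet B) :
    MeasurableSet {p : ℕ × (ℕ → EuclideanSpace ℝ (Fin d)) | dilatedSample T p ∩ B = ∅} := by
  simp only [dilatedSample_inter_eq_empty_iff]
  have : {p : ℕ × (ℕ → EuclideanSpace ℝ (Fin d)) | ∀ i < p.1, p.2 i ∈ (fun x => T • x) ⁻¹' Bᶜ}
      = ⋂ i : ℕ, (Prod.fst ⁻¹' Set.Iic i ∪
        (fun p : ℕ × (ℕ → EuclideanSpace ℝ (Fin d)) => p.2 i) ⁻¹' ((fun x => T • x) ⁻¹' Bᶜ)) := by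
    ext p
    simp only [Set.mem_ofPred_eq, Set.mem_iInter, Set.mem_union, Set.mem_preimage, Set.mem_Iic]
    exact forall_congr' fun i => by rw [← not_lt, imp_iff_not_or]
  rw [this]
  refine MeasurableSet.iInter fun i => (measurable_fst (measurableSet_Iic)).union ?_
  exact (hB.compl.preimage (by fun_prop)).preimage (by fun_prop)

/-- The law of a Poisson number of points together with a sequence of independent uniform points
of the unit cube. -/
noncomputable def poissonSampleLaw (d : ℕ) (r : NNReal) :
    Measure (ℕ × (ℕ → EuclideanSpace ℝ (Fin d))) :=
  (poissonMeasure r).prod (Measure.infinitePi fun _ => uniformCube d)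

instance (d : ℕ) (r : NNReal) : IsProbabilityMeasure (poissonSampleLaw d r) := by
  unfold poissonSampleLaw; infer_instance

/-- The void probabilities of the dilated sample are those of a Poisson process on `[0, T]^d`:
given `n` points the void probability is `q ^ n`, and the Poisson generating function at `q`
gives the exponential. -/
theorem poissonSampleLaw_void {lam T : ℝ} (hlam : 0 ≤ lam) (hT : 0 < T)
    {B : Set (EuclideanSpace ℝ (Fin d))} (hB : MeasurableSet B) :
    poissonSampleLaw d (lam * T ^ d).toNNReal {p | dilatedSample T p ∩ B = ∅}
      = ENNReal.ofReal (Real.exp (-(lam * volume.real (cube d T ∩ B)))) := by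
  have hq : uniformCube d ((fun x => T • x) ⁻¹' Bᶜ)
      = ENNReal.ofReal (1 - volume.real (cube d T ∩ B) / T ^ d) := by
    rw [← uniformCube_preimage_smul hT B hB, Set.preimage_compl,
      ← probReal_compl_eq_one_sub (hB.preimage (by fun_prop)), ofReal_measureReal]
  have hq0 : 0 ≤ 1 - volume.real (cube d T ∩ B) / T ^ d := by
    rw [← uniformCube_preimage_smul hT B hB, sub_nonneg]
    exact measureReal_le_one
  have hsec : ∀ n : ℕ, Measure.infinitePi (fun _ : ℕ => uniformCube d)
      (Prod.mk n ⁻¹' {p | dilatedSample T p ∩ B = ∅})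
      = ENNReal.ofReal (1 - volume.real (cube d T ∩ B) / T ^ d) ^ n := by
    intro n
    have : Prod.mk n ⁻¹' {p : ℕ × (ℕ → EuclideanSpace ℝ (Fin d)) | dilatedSample T p ∩ B = ∅}
        = Set.pi (Finset.range n : Set ℕ) fun _ => (fun x => T • x) ⁻¹' Bᶜ := by
      ext x
      simp [dilatedSample_inter_eq_empty_iff, Set.mem_pi]
    rw [this, Measure.infinitePi_pi _ fun _ _ => hB.compl.preimage (by fun_prop),
      Finset.prod_const, Finset.card_range, hq]
  rw [poissonSampleLaw, Measure.prod_apply (measurableSet_dilatedSample_void T hB)]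
  simp only [hsec]
  rw [lintegral_pow_poissonMeasure _ hq0, Real.coe_toNNReal _ (by positivity)]
  congr 2
  have := (pow_pos hT d).ne'
  field_simp
  ring

theorem measurable_numColoured_dilatedSample {k : ℕ} (hk : 1 ≤ k) (r T : ℝ) :
    Measurable fun p : ℕ × (ℕ → EuclideanSpace ℝ (Fin d)) =>
      (numColoured k r (dilatedSample T p) : ℝ) :=
  measurable_numColoured hk r (finite_dilatedSample T)
    fun _ hB => measurableSet_dilatedSample_void T hB

theorem numColoured_dilatedSample_le {k : ℕ} (hk : 1 ≤ k) (r T : ℝ)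
    (p : ℕ × (ℕ → EuclideanSpace ℝ (Fin d))) :
    numColoured k r (dilatedSample T p) ≤ p.1 :=
  (numColoured_le_ncard hk r (finite_dilatedSample T p)).trans (ncard_dilatedSample_le T p)

theorem numColoured_dilatedSample_le_add {k : ℕ} (hk : 1 ≤ k) (r T : ℝ) (m n : ℕ)
    (x : ℕ → EuclideanSpace ℝ (Fin d)) :
    (numColoured k r (dilatedSample T (m, x)) : ℝ)
      ≤ numColoured k r (dilatedSample T (n, x)) + |(m : ℝ) - n| := by
  have h : dilatedSample T (m, x)
      ⊆ dilatedSample T (n, x) ∪ (fun i => T • x i) '' Set.Ico n m := by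
    rw [dilatedSample, dilatedSample, ← Set.image_union]
    refine Set.image_mono fun i hi => ?_
    rcases lt_or_ge i n with h | h
    · exact Or.inl h
    · exact Or.inr ⟨h, hi⟩
  have h1 := numColoured_le_add_ncard hk r (finite_dilatedSample T (n, x))
    ((Set.finite_Ico n m).image _) h
  have h2 : ((fun i => T • x i) '' Set.Ico n m).ncard ≤ m - n := by
    refine (Set.ncard_image_le (Set.finite_Ico n m)).trans ?_
    simp [Set.ncard_eq_toFinset_card']
  have h3 : ((m - n : ℕ) : ℝ) ≤ |(m : ℝ) - n| := by
    rcases le_total n m with h | h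
    · rw [Nat.cast_sub h]
      exact le_abs_self _
    · rw [Nat.sub_eq_zero_of_le h]
      simp
  calc (numColoured k r (dilatedSample T (m, x)) : ℝ)
      ≤ ((numColoured k r (dilatedSample T (n, x)) + (m - n) : ℕ) : ℝ) :=
        Nat.cast_le.2 (h1.trans (Nat.add_le_add_left h2 _))
    _ ≤ _ := by
        push_cast
        exact add_le_add_right h3 _

theorem abs_numColoured_dilatedSample_sub_le {k : ℕ} (hk : 1 ≤ k) (r T : ℝ) (m n : ℕ)
    (x : ℕ → EuclideanSpace ℝ (Fin d)) :
    |(numColoured k r (dilatedSample T (m, x)) : ℝ) - numColoured k r (dilatedSample T (n, x))|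
      ≤ |(m : ℝ) - n| := by
  have h1 := numColoured_dilatedSample_le_add hk r T m n x
  have h2 := numColoured_dilatedSample_le_add hk r T n m x
  rw [abs_sub_comm] at h2
  exact abs_sub_le_iff.2 ⟨by linarith, by linarith⟩

/-- On `[0, T]^d` a Poisson process can be replaced by a Poisson number of independent uniform
points: both have the same void probabilities. -/
theorem IsPoissonPointProcess.integral_numColoured_cube {Ω : Type*} [MeasurableSpace Ω]
    {P : Measure Ω} [IsProbabilityMeasure P] {X : Ω → Set (EuclideanSpace ℝ (Fin d))} {lam : ℝ}
    {k : ℕ} (hk : 1 ≤ k) (r : ℝ) (hX : IsPoissonPointProcess lam X P) (hlam : 0 ≤ lam)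
    {T : ℝ} (hT : 0 < T) :
    ∫ ω, (numColoured k r (X ω ∩ cube d T) : ℝ) ∂P
      = ∫ p, (numColoured k r (dilatedSample T p) : ℝ)
        ∂(poissonSampleLaw d (lam * T ^ d).toNNReal) := by
  have hB := measurableSet_cube d T
  have hb := isBounded_cube d T
  refine integral_numColoured_eq_of_void_eq hk r (fun ω => hX.locallyFinite ω _ hb)
    (finite_dilatedSample T) (fun A hA => ?_)
    (fun A hA => (measurableSet_dilatedSample_void T hA).nullMeasurableSet)
    (hX.integrable_ncard hB hb) (fun ω => le_rfl)
    (g' := fun p => (p.1 : ℝ)) ((integrable_natCast_poissonMeasure _).comp_fst _)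
    (fun p => Nat.cast_le.2 (ncard_dilatedSample_le T p)) fun A hA => ?_
  · simp only [Set.inter_assoc]
    exact hX.nullMeasurableSet_void (hB.inter hA) (hb.subset Set.inter_subset_left)
  · simp only [Set.inter_assoc]
    rw [hX.measure_void hlam (hB.inter hA) (hb.subset Set.inter_subset_left),
      poissonSampleLaw_void hlam hT hA]

/-- De-Poissonization: replacing the Poisson number of points by its mean `n` changes the expected
number of colourable points by at most `√n`. -/
theorem abs_integral_poissonSampleLaw_sub_le {k : ℕ} (hk : 1 ≤ k) (r T : ℝ) {n : ℕ} (hn : 0 < n) :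
    |(∫ p, (numColoured k r (dilatedSample T p) : ℝ) ∂(poissonSampleLaw d (n : NNReal)))
      - ∫ x, (numColoured k r (dilatedSample T (n, x)) : ℝ)
        ∂(Measure.infinitePi fun _ => uniformCube d)| ≤ √n := by
  set μ := Measure.infinitePi fun _ : ℕ => uniformCube d
  have hmeas := measurable_numColoured_dilatedSample (d := d) hk r T
  have hint : ∀ m : ℕ, Integrable (fun x => (numColoured k r (dilatedSample T (m, x)) : ℝ)) μ :=
    fun m => .of_bound (hmeas.comp measurable_prodMk_left).aestronglyMeasurable m
      (Eventually.of_forall fun x => by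
        rw [Real.norm_natCast, Nat.cast_le]
        exact numColoured_dilatedSample_le hk r T (m, x))
  have hfst : Integrable (fun p : ℕ × (ℕ → EuclideanSpace ℝ (Fin d)) => (p.1 : ℝ))
      ((poissonMeasure (n : NNReal)).prod μ) :=
    (integrable_natCast_poissonMeasure _).comp_fst _
  have hintp : Integrable (fun p => (numColoured k r (dilatedSample T p) : ℝ))
      ((poissonMeasure (n : NNReal)).prod μ) :=
    hfst.mono' hmeas.aestronglyMeasurable (Eventually.of_forall fun p => by
      rw [Real.norm_natCast, Nat.cast_le]
      exact numColoured_dilatedSample_le hk r T p)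
  rw [poissonSampleLaw, integral_prod _ hintp]
  set c := ∫ x, (numColoured k r (dilatedSample T (n, x)) : ℝ) ∂μ
  have hc : c = ∫ _ : ℕ, c ∂(poissonMeasure (n : NNReal)) := by simp
  rw [hc, ← integral_sub hintp.integral_prod_left (integrable_const _), ← Real.norm_eq_abs]
  have hbound := integral_abs_sub_poissonMeasure_le (r := (n : NNReal)) (by exact_mod_cast hn)
  rw [NNReal.coe_natCast] at hbound
  refine (norm_integral_le_of_norm_le (g := fun m : ℕ => |(m : ℝ) - n|) ?_ ?_).trans hbound
  · exact ((integrable_natCast_poissonMeasure _).sub (integrable_const _)).abs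
  · refine Eventually.of_forall fun m => ?_
    rw [← integral_sub (hint m) (hint n)]
    refine (norm_integral_le_of_norm_le_const (Eventually.of_forall fun x => ?_)).trans_eq
      (by rw [probReal_univ, mul_one])
    exact abs_numColoured_dilatedSample_sub_le hk r T m n x

end Sampling

/-! ### The bounded differences inequality -/

section BoundedDifferences

variable {E : Type*} [MeasurableSpace E]

/-- Sub-Gaussianity on a product space from sub-Gaussianity of the conditional deviation and of the
conditional expectation. -/
theorem HasSubgaussianMGF.prod_of_sections {F : Type*} [MeasurableSpace F] {U : Measure E}
    {ν : Measure F} [IsProbabilityMeasure U] [IsProbabilityMeasure ν] {h : E × F → ℝ}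
    (hm : Measurable h) {C : ℝ} (hC : ∀ p, |h p| ≤ C) {c c' : NNReal}
    (hsec : ∀ a, HasSubgaussianMGF (fun x => h (a, x) - ∫ y, h (a, y) ∂ν) c ν)
    (hmean : HasSubgaussianMGF (fun a => (∫ y, h (a, y) ∂ν) - ∫ b, ∫ y, h (b, y) ∂ν ∂U) c' U) :
    HasSubgaussianMGF (fun p => h p - ∫ q, h q ∂(U.prod ν)) (c + c') (U.prod ν) := by
  have hint : Integrable h (U.prod ν) :=
    .of_bound hm.aestronglyMeasurable C (Eventually.of_forall hC)
  rw [integral_prod h hint]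
  set m := ∫ b, ∫ y, h (b, y) ∂ν ∂U
  have hexp : ∀ t : ℝ, Integrable (fun p => Real.exp (t * (h p - m))) (U.prod ν) := by
    intro t
    refine .of_bound (by fun_prop) (Real.exp (|t| * (C + |m|)))
      (Eventually.of_forall fun p => ?_)
    rw [Real.norm_eq_abs, abs_of_pos (Real.exp_pos _), Real.exp_le_exp]
    calc t * (h p - m) ≤ |t| * |h p - m| := (le_abs_self _).trans (abs_mul _ _).le
      _ ≤ |t| * (C + |m|) :=
        mul_le_mul_of_nonneg_left ((abs_sub _ _).trans (add_le_add_left (hC p) _)) (abs_nonneg t)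
  refine ⟨hexp, fun t => ?_⟩
  have hmean_int := hmean.integrable_exp_mul t
  rw [mgf, integral_prod _ (hexp t)]
  calc ∫ a, ∫ x, Real.exp (t * (h (a, x) - m)) ∂ν ∂U
      ≤ ∫ a, Real.exp (t * ((∫ y, h (a, y) ∂ν) - m)) * Real.exp (c * t ^ 2 / 2) ∂U := by
        refine integral_mono (hexp t).integral_prod_left (hmean_int.mul_const _) fun a => ?_
        have e : ∀ x, Real.exp (t * (h (a, x) - m)) = Real.exp (t * ((∫ y, h (a, y) ∂ν) - m)) *
            Real.exp (t * (h (a, x) - ∫ y, h (a, y) ∂ν)) := by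
          intro x
          rw [← Real.exp_add]
          ring_nf
        simp only [e]
        rw [integral_const_mul]
        exact mul_le_mul_of_nonneg_left ((hsec a).mgf_le t) (Real.exp_pos _).le
    _ = mgf (fun a => (∫ y, h (a, y) ∂ν) - m) U t * Real.exp (c * t ^ 2 / 2) := by
        rw [integral_mul_const, mgf]
    _ ≤ Real.exp (c' * t ^ 2 / 2) * Real.exp (c * t ^ 2 / 2) :=
        mul_le_mul_of_nonneg_right (hmean.mgf_le t) (Real.exp_pos _).le
    _ = Real.exp ((c + c' : NNReal) * t ^ 2 / 2) := by
        rw [← Real.exp_add]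
        push_cast
        ring_nf

/-- McDiarmid's bounded differences inequality in sub-Gaussian form: a function of `n` independent
variables that changes by at most `1` when one of them is changed is sub-Gaussian with variance
proxy `n`. By induction on `n`: conditionally on the first variable the induction hypothesis
applies, and Hoeffding's lemma applies to the conditional expectation. -/
theorem hasSubgaussianMGF_of_bounded_differences (U : Measure E) [IsProbabilityMeasure U] (n : ℕ)
    (f : (Fin n → E) → ℝ) (hf : Measurable f) {C : ℝ} (hC : ∀ x, |f x| ≤ C)
    (hdiff : ∀ x i y, |f (Function.update x i y) - f x| ≤ 1) :
    HasSubgaussianMGF (fun x => f x - ∫ y, f y ∂(Measure.pi fun _ => U)) n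
      (Measure.pi fun _ => U) := by
  induction n with
  | zero =>
    have : (fun x => f x - ∫ y, f y ∂(Measure.pi fun _ : Fin 0 => U)) = fun _ => 0 := by
      funext x
      have : ∀ y, f y = f x := fun y => congrArg f (Subsingleton.elim _ _)
      simp [this]
    rw [this]
    simp
  | succ n ih =>
    set e := MeasurableEquiv.piFinSuccAbove (fun _ : Fin (n + 1) => E) 0 with he
    have hmp : MeasurePreserving e (Measure.pi fun _ => U) (U.prod (Measure.pi fun _ => U)) :=
      measurePreserving_piFinSuccAbove (fun _ => U) 0
    have hcons : ∀ a x, e.symm (a, x) = Fin.cons a x := fun a x => by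
      simp [he, MeasurableEquiv.piFinSuccAbove, Fin.insertNthEquiv]
    have hm : Measurable (f ∘ e.symm) := hf.comp e.symm.measurable
    have hint : ∀ a, Integrable (fun x => (f ∘ e.symm) (a, x)) (Measure.pi fun _ : Fin n => U) :=
      fun a => .of_bound (hm.comp measurable_prodMk_left).aestronglyMeasurable C
        (Eventually.of_forall fun x => hC _)
    have hsec : ∀ a, HasSubgaussianMGF (fun x => (f ∘ e.symm) (a, x) -
        ∫ y, (f ∘ e.symm) (a, y) ∂(Measure.pi fun _ => U)) n (Measure.pi fun _ => U) := by
      intro a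
      refine ih (fun x => (f ∘ e.symm) (a, x)) (hm.comp measurable_prodMk_left)
        (fun x => hC _) fun x i y => ?_
      simp only [Function.comp_apply, hcons, Fin.cons_update]
      exact hdiff _ _ _
    have hgdiff : ∀ a b, |(∫ y, (f ∘ e.symm) (a, y) ∂(Measure.pi fun _ => U)) -
        ∫ y, (f ∘ e.symm) (b, y) ∂(Measure.pi fun _ => U)| ≤ 1 := by
      intro a b
      rw [← integral_sub (hint a) (hint b), ← Real.norm_eq_abs]
      refine (norm_integral_le_of_norm_le_const (C := 1)
        (Eventually.of_forall fun x => ?_)).trans (by simp)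
      have h := hdiff (Fin.cons b x) 0 a
      rw [Fin.update_cons_zero] at h
      simpa [hcons] using h
    have hmean : HasSubgaussianMGF (fun a => (∫ y, (f ∘ e.symm) (a, y) ∂(Measure.pi fun _ => U)) -
        ∫ b, ∫ y, (f ∘ e.symm) (b, y) ∂(Measure.pi fun _ => U) ∂U) 1 U := by
      -- The interval of radius `1` about one value has length `2`, so Hoeffding's lemma gives
      -- the variance proxy `(2 / 2) ^ 2 = 1`.
      obtain ⟨a₀⟩ := U.nonempty_of_neZero
      have h := hasSubgaussianMGF_of_mem_Icc (μ := U)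
        (X := fun a => ∫ y, (f ∘ e.symm) (a, y) ∂(Measure.pi fun _ => U))
        (a := (∫ y, (f ∘ e.symm) (a₀, y) ∂(Measure.pi fun _ => U)) - 1)
        (b := (∫ y, (f ∘ e.symm) (a₀, y) ∂(Measure.pi fun _ => U)) + 1)
        (hm.stronglyMeasurable.integral_prod_right').measurable.aemeasurable
        (Eventually.of_forall fun a => by
          have := abs_le.1 (hgdiff a a₀)
          constructor <;> linarith)
      convert h using 1
      ext
      norm_num
    have hprod := HasSubgaussianMGF.prod_of_sections hm (fun p => hC _) hsec hmean
    rw [← hmp.map_eq] at hprod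
    have h := hprod.of_map hmp.measurable.aemeasurable
    rw [integral_map hmp.measurable.aemeasurable hm.aestronglyMeasurable] at h
    push_cast
    simpa [Function.comp_def] using h

/-- The two-sided Chernoff bound which follows from bounded differences. -/
theorem measureReal_bounded_differences_le {U : Measure E} [IsProbabilityMeasure U] {n : ℕ}
    {f : (Fin n → E) → ℝ} (hf : Measurable f) {C : ℝ} (hC : ∀ x, |f x| ≤ C)
    (hdiff : ∀ x i y, |f (Function.update x i y) - f x| ≤ 1) {ε : ℝ} (hε : 0 ≤ ε) :
    (Measure.pi fun _ => U).real {x | n * ε ≤ |f x - ∫ y, f y ∂(Measure.pi fun _ => U)|}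
      ≤ 2 * Real.exp (-(ε ^ 2 / 2)) ^ n := by
  have h := hasSubgaussianMGF_of_bounded_differences U n f hf hC hdiff
  have hnε : 0 ≤ n * ε := by positivity
  have hexp : Real.exp (-(n * ε) ^ 2 / (2 * (n : NNReal))) = Real.exp (-(ε ^ 2 / 2)) ^ n := by
    rw [← Real.exp_nat_mul]
    congr 1
    rcases n.eq_zero_or_pos with rfl | hn
    · simp
    · push_cast
      field_simp
  have h1 := h.measure_ge_le hnε
  have h2 := h.neg.measure_ge_le hnε
  rw [hexp] at h1 h2
  rw [two_mul]
  refine le_trans (measureReal_mono fun x hx => ?_) ((measureReal_union_le _ _).trans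
    (add_le_add h1 h2))
  have hx' : n * ε ≤ |f x - ∫ y, f y ∂(Measure.pi fun _ => U)| := hx
  exact (le_abs.1 hx').imp id id

end BoundedDifferences

/-! ### Convergence of the mean and of the random ratio -/

section MeanLimit

variable {d : ℕ} {Ω : Type*} [MeasurableSpace Ω] {P : Measure Ω}
  {X : Ω → Set (EuclideanSpace ℝ (Fin d))} {lam : ℝ} {k : ℕ}

theorem meanColouringRatio_eq (X : Ω → Set (EuclideanSpace ℝ (Fin d))) (P : Measure Ω) (k : ℕ)
    (lam t : ℝ) :
    meanColouringRatio X P k lam t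
      = (∫ ω, (numColoured k 1 (X ω ∩ cube d t) : ℝ) ∂P) / (lam * t ^ d) := by
  simp only [meanColouringRatio, poissonColoured, Set.inter_comm (cube d t)]
  rw [integral_div]

/-- The cube `[0, T]^d` is covered by `(⌊T / t⌋ + 1) ^ d` translates of `[0, t]^d`. -/
theorem cube_subset_biUnion_translates {t : ℝ} (ht : 0 < t) (T : ℝ) :
    cube d T ⊆ ⋃ z ∈ Fintype.piFinset (fun _ : Fin d => Finset.range (⌊T / t⌋₊ + 1)),
      (fun x => x - WithLp.toLp 2 (fun i => t * (z i : ℝ))) ⁻¹' cube d t := by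
  intro x hx
  have h0 : ∀ i, 0 ≤ x i / t := fun i => div_nonneg (hx i).1 ht.le
  simp only [Set.mem_iUnion]
  refine ⟨fun i => ⌊x i / t⌋₊, ?_, fun i => ?_⟩
  · rw [Fintype.mem_piFinset]
    intro i
    rw [Finset.mem_range, Nat.lt_succ_iff]
    exact Nat.floor_le_floor (div_le_div_of_nonneg_right (hx i).2 ht.le)
  · have h1 := Nat.floor_le (h0 i)
    have h2 := (Nat.lt_floor_add_one (x i / t)).le
    rw [le_div_iff₀ ht] at h1
    rw [div_le_iff₀ ht] at h2
    simp only [PiLp.sub_apply, Set.mem_Icc]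
    constructor <;> linarith

theorem IsPoissonPointProcess.integral_numColoured_cube_le [IsProbabilityMeasure P] (hk : 1 ≤ k)
    (r : ℝ) (hX : IsPoissonPointProcess lam X P) (hlam : 0 ≤ lam) {t : ℝ} (ht : 0 < t) (T : ℝ) :
    ∫ ω, (numColoured k r (X ω ∩ cube d T) : ℝ) ∂P
      ≤ ((⌊T / t⌋₊ : ℝ) + 1) ^ d * ∫ ω, (numColoured k r (X ω ∩ cube d t) : ℝ) ∂P := by
  set s := Fintype.piFinset (fun _ : Fin d => Finset.range (⌊T / t⌋₊ + 1)) with hs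
  set B : (Fin d → ℕ) → Set (EuclideanSpace ℝ (Fin d)) := fun z =>
    (fun x => x - WithLp.toLp 2 (fun i => t * (z i : ℝ))) ⁻¹' cube d t with hBdef
  have hBm : ∀ z, MeasurableSet (B z) := fun z => (measurableSet_cube d t).preimage (by fun_prop)
  have hBb : ∀ z, Bornology.IsBounded (B z) := fun z =>
    (AntilipschitzWith.of_le_mul_dist (K := 1) fun x y => by simp).isBounded_preimage
      (isBounded_cube d t)
  have hint := fun z => hX.integrable_numColoured hk r (hBm z) (hBb z)
  have hle : ∀ ω, (numColoured k r (X ω ∩ cube d T) : ℝ)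
      ≤ ∑ z ∈ s, (numColoured k r (X ω ∩ B z) : ℝ) := by
    intro ω
    rw [← Nat.cast_sum, Nat.cast_le]
    refine numColoured_biUnion_le hk r s (fun z => hX.locallyFinite ω _ (hBb z)) ?_
    rw [← Set.inter_iUnion₂]
    exact Set.inter_subset_inter_right _ (cube_subset_biUnion_translates ht T)
  calc ∫ ω, (numColoured k r (X ω ∩ cube d T) : ℝ) ∂P
      ≤ ∫ ω, ∑ z ∈ s, (numColoured k r (X ω ∩ B z) : ℝ) ∂P :=
        integral_mono (hX.integrable_numColoured hk r (measurableSet_cube d T) (isBounded_cube d T))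
          (integrable_finsetSum _ fun z _ => hint z) hle
    _ = ∑ z ∈ s, ∫ ω, (numColoured k r (X ω ∩ cube d t) : ℝ) ∂P := by
        rw [integral_finsetSum _ fun z _ => hint z]
        exact Finset.sum_congr rfl fun z _ => hX.integral_numColoured_translate hk r hlam
          (measurableSet_cube d t) (isBounded_cube d t) _
    _ = _ := by
        rw [Finset.sum_const, hs, Fintype.card_piFinset]
        simp

/-- The multidimensional Fekete argument: the mean colouring ratio converges to its infimum. -/
theorem IsPoissonPointProcess.tendsto_meanColouringRatio [IsProbabilityMeasure P] (hk : 1 ≤ k)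
    (hX : IsPoissonPointProcess lam X P) (hlam : 0 < lam) :
    Tendsto (meanColouringRatio X P k lam) atTop (𝓝 (colouringConstant X P k lam)) := by
  have hnonneg : ∀ t : ℝ, 0 < t → 0 ≤ meanColouringRatio X P k lam t := fun t ht =>
    integral_nonneg fun ω => by positivity
  have hbdd : BddBelow (Set.range fun t : Set.Ioi (0 : ℝ) => meanColouringRatio X P k lam t) :=
    ⟨0, by rintro _ ⟨t, rfl⟩; exact hnonneg t t.2⟩
  refine tendsto_order.2 ⟨fun b hb => ?_, fun b hb => ?_⟩
  · filter_upwards [eventually_gt_atTop 0] with T hT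
    exact hb.trans_le (ciInf_le hbdd ⟨T, hT⟩)
  · obtain ⟨⟨t, ht⟩, htb⟩ := exists_lt_of_ciInf_lt hb
    have ht : 0 < t := ht
    have hlim : Tendsto (fun T : ℝ => (1 + t / T) ^ d * meanColouringRatio X P k lam t) atTop
        (𝓝 (meanColouringRatio X P k lam t)) := by
      have h := (((tendsto_const_nhds (x := t)).div_atTop tendsto_id).const_add 1).pow d
      simpa using h.mul_const (meanColouringRatio X P k lam t)
    filter_upwards [hlim.eventually_lt_const htb, eventually_gt_atTop 0] with T hT hT0
    refine lt_of_le_of_lt ?_ hT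
    have hm : 0 ≤ ∫ ω, (numColoured k 1 (X ω ∩ cube d t) : ℝ) ∂P :=
      integral_nonneg fun ω => by positivity
    rw [meanColouringRatio_eq, meanColouringRatio_eq, div_le_iff₀ (by positivity)]
    refine (hX.integral_numColoured_cube_le hk 1 hlam.le ht T).trans ?_
    have hfl : (⌊T / t⌋₊ : ℝ) ≤ T / t := Nat.floor_le (by positivity)
    calc ((⌊T / t⌋₊ : ℝ) + 1) ^ d * ∫ ω, (numColoured k 1 (X ω ∩ cube d t) : ℝ) ∂P
        ≤ (T / t + 1) ^ d * ∫ ω, (numColoured k 1 (X ω ∩ cube d t) : ℝ) ∂P := by gcongr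
      _ = _ := by
        have e : T / t + 1 = (1 + t / T) * (T / t) := by field_simp
        rw [e, mul_pow, div_pow]
        field_simp

end MeanLimit

section BinomialProcess

variable {d k : ℕ}

theorem measurable_numColoured_range (hk : 1 ≤ k) (r : ℝ) (n : ℕ) :
    Measurable fun x : Fin n → EuclideanSpace ℝ (Fin d) =>
      (numColoured k r (Set.range x) : ℝ) := by
  refine measurable_numColoured hk r (fun x => Set.finite_range x) fun B hB => ?_
  have : {x : Fin n → EuclideanSpace ℝ (Fin d) | Set.range x ∩ B = ∅}
      = ⋂ i, (fun x => x i) ⁻¹' Bᶜ := by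
    ext x
    simp [Set.eq_empty_iff_forall_notMem]
  rw [this]
  exact MeasurableSet.iInter fun i => hB.compl.preimage (by fun_prop)

theorem numColoured_range_le (hk : 1 ≤ k) (r : ℝ) {n : ℕ} (x : Fin n → EuclideanSpace ℝ (Fin d)) :
    numColoured k r (Set.range x) ≤ n := by
  refine (numColoured_le_ncard hk r (Set.finite_range x)).trans ?_
  rw [← Set.image_univ]
  exact (Set.ncard_image_le Set.finite_univ).trans (by simp [Set.ncard_univ])

theorem abs_numColoured_range_update_sub_le (hk : 1 ≤ k) (r : ℝ) {n : ℕ}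
    (x : Fin n → EuclideanSpace ℝ (Fin d)) (i : Fin n) (y : EuclideanSpace ℝ (Fin d)) :
    |(numColoured k r (Set.range (Function.update x i y)) : ℝ) - numColoured k r (Set.range x)|
      ≤ 1 := by
  have key : ∀ (u : Fin n → EuclideanSpace ℝ (Fin d)) (z : EuclideanSpace ℝ (Fin d)),
      (numColoured k r (Set.range (Function.update u i z)) : ℝ)
        ≤ numColoured k r (Set.range u) + 1 := by
    intro u z
    have h : Set.range (Function.update u i z) ⊆ Set.range u ∪ {z} := by
      rintro _ ⟨j, rfl⟩
      by_cases hj : j = i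
      · subst hj
        right
        simp
      · left
        exact ⟨j, by simp [hj]⟩
    have := numColoured_le_add_ncard hk r (Set.finite_range u) (Set.finite_singleton z) h
    rw [Set.ncard_singleton] at this
    exact_mod_cast this
  have h1 := key x y
  have h2 := key (Function.update x i y) (x i)
  rw [Function.update_idem, Function.update_eq_self] at h2
  exact abs_sub_le_iff.2 ⟨by linarith, by linarith⟩

/-- Rescaling: `n` points of the unit cube at scale `T⁻¹` are the same as the dilated points at
scale `1`. -/
theorem numColoured_range_eq_dilatedSample (hk : 1 ≤ k) {T : ℝ} (hT : 0 < T) (n : ℕ)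
    (x : ℕ → EuclideanSpace ℝ (Fin d)) :
    numColoured k T⁻¹ (Set.range fun i : Fin n => x i)
      = numColoured k 1 (dilatedSample T (n, x)) := by
  have h : dilatedSample T (n, x) = (fun y => T • y) '' Set.range fun i : Fin n => x i := by
    ext y
    simp only [dilatedSample, Set.mem_image, Set.mem_Iio, Set.mem_range, exists_exists_eq_and]
    exact ⟨fun ⟨i, hi, h⟩ => ⟨⟨i, hi⟩, h⟩, fun ⟨i, h⟩ => ⟨i, i.2, h⟩⟩
  rw [h]
  refine (numColoured_image hk (Set.finite_range _)
    (smul_right_injective _ hT.ne').injOn fun u _ v _ => ?_).symm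
  rw [dist_smul₀, Real.norm_of_nonneg hT.le, ← one_div, le_div_iff₀' hT]

theorem integral_numColoured_range (hk : 1 ≤ k) {T : ℝ} (hT : 0 < T) (n : ℕ) :
    ∫ x, (numColoured k T⁻¹ (Set.range x) : ℝ) ∂(Measure.pi fun _ : Fin n => uniformCube d)
      = ∫ x, (numColoured k 1 (dilatedSample T (n, x)) : ℝ)
        ∂(Measure.infinitePi fun _ => uniformCube d) := by
  have hproj : Measurable fun (x : ℕ → EuclideanSpace ℝ (Fin d)) (i : Fin n) => x i :=
    measurable_pi_lambda _ fun i => measurable_pi_apply _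
  have hmap : (Measure.infinitePi fun _ : ℕ => uniformCube d).map (fun x (i : Fin n) => x i)
      = Measure.pi fun _ : Fin n => uniformCube d := by
    refine (Measure.pi_eq fun s hs => ?_).symm
    rw [Measure.map_apply hproj (MeasurableSet.univ_pi hs)]
    -- Pad the box by the whole space in the coordinates beyond `n`.
    set s' : ℕ → Set (EuclideanSpace ℝ (Fin d)) := fun i =>
      if h : i < n then s ⟨i, h⟩ else Set.univ with hs'
    have hpre : (fun x (i : Fin n) => x i) ⁻¹' Set.univ.pi s
        = Set.pi (Finset.range n : Set ℕ) s' := by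
      ext x
      simp only [Set.mem_preimage, Set.mem_pi, Set.mem_univ, true_imp_iff, Finset.coe_range,
        Set.mem_Iio]
      constructor
      · intro h i hi
        simpa [hs', hi] using h ⟨i, hi⟩
      · intro h i
        simpa [hs'] using h i i.2
    rw [hpre, Measure.infinitePi_pi _ fun i hi => ?_, Finset.prod_range]
    · simp [hs']
    · have hi : i < n := Finset.mem_range.1 hi
      simpa [hs', hi] using hs ⟨i, hi⟩
  rw [← hmap, integral_map hproj.aemeasurable
    (measurable_numColoured_range hk _ n).aestronglyMeasurable]
  simp only [numColoured_range_eq_dilatedSample hk hT]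

/-- The expected proportion of colourable points among `n` uniform points converges to the
colouring constant of the Poisson process. -/
theorem tendsto_integral_numColoured_range_div (hd : 1 ≤ d) (hk : 1 ≤ k) {ν : ℝ} (hν : 0 < ν)
    {Ω : Type*} [MeasurableSpace Ω] {P : Measure Ω} [IsProbabilityMeasure P]
    {X : Ω → Set (EuclideanSpace ℝ (Fin d))} (hX : IsPoissonPointProcess ν X P) :
    Tendsto (fun n : ℕ => (∫ x, (numColoured k ((ν / (n : ℝ)) ^ (1 / (d : ℝ))) (Set.range x) : ℝ)
      ∂(Measure.pi fun _ : Fin n => uniformCube d)) / n) atTop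
      (𝓝 (colouringConstant X P k ν)) := by
  set T : ℕ → ℝ := fun n => ((n : ℝ) / ν) ^ (1 / (d : ℝ)) with hTdef
  have hTlim : Tendsto T atTop atTop :=
    (tendsto_rpow_atTop (by positivity)).comp
      (tendsto_natCast_atTop_atTop.atTop_div_const hν)
  have hratio := (hX.tendsto_meanColouringRatio hk hν).comp hTlim
  have hsqrt : Tendsto (fun n : ℕ => 1 / √(n : ℝ)) atTop (𝓝 0) :=
    tendsto_const_nhds.div_atTop (Real.tendsto_sqrt_atTop.comp tendsto_natCast_atTop_atTop)
  refine tendsto_of_tendsto_of_dist hratio (squeeze_zero' (Eventually.of_forall fun _ =>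
    dist_nonneg) ?_ hsqrt)
  filter_upwards [eventually_gt_atTop 0] with n hn
  have hn' : (0 : ℝ) < n := by exact_mod_cast hn
  have hT : 0 < T n := Real.rpow_pos_of_pos (by positivity) _
  have hTinv : (ν / (n : ℝ)) ^ (1 / (d : ℝ)) = (T n)⁻¹ := by
    rw [hTdef, ← Real.inv_rpow (by positivity), inv_div]
  have hTpow : ν * T n ^ d = n := by
    rw [hTdef, one_div, Real.rpow_inv_natCast_pow (by positivity) (by lia)]
    field_simp
  have h := abs_integral_poissonSampleLaw_sub_le (d := d) hk 1 (T n) hn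
  have hcube := hX.integral_numColoured_cube hk 1 hν.le hT
  rw [hTpow, Real.toNNReal_natCast] at hcube
  rw [Function.comp_apply, meanColouringRatio_eq, hTpow, hTinv, integral_numColoured_range hk hT,
    hcube, Real.dist_eq, ← sub_div, abs_div, abs_of_pos hn', div_le_div_iff₀ hn' (by positivity)]
  calc _ ≤ √(n : ℝ) * √(n : ℝ) := mul_le_mul_of_nonneg_right h (Real.sqrt_nonneg _)
    _ = _ := by rw [Real.mul_self_sqrt hn'.le, one_mul]

/-- McDiarmid's inequality and the Borel–Cantelli lemma; no assumption on the joint law for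
different `n` is needed since the tail bounds are summable. -/
theorem ae_tendsto_numColoured_sub_integral (hk : 1 ≤ k) (r : ℕ → ℝ)
    {Ω : Type*} [MeasurableSpace Ω] {P : Measure Ω} [IsProbabilityMeasure P]
    {ξ : (n : ℕ) → Fin n → Ω → EuclideanSpace ℝ (Fin d)} (hmeas : ∀ n i, Measurable (ξ n i))
    (hlaw : ∀ n i, P.map (ξ n i) = uniformCube d) (hindep : ∀ n, iIndepFun (ξ n) P) :
    ∀ᵐ ω ∂P, Tendsto (fun n : ℕ => (numColoured k (r n) (Set.range fun i => ξ n i ω) : ℝ) / n -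
      (∫ x, (numColoured k (r n) (Set.range x) : ℝ)
        ∂(Measure.pi fun _ : Fin n => uniformCube d)) / n) atTop (𝓝 0) := by
  set m : ℕ → ℝ := fun n => ∫ x, (numColoured k (r n) (Set.range x) : ℝ)
    ∂(Measure.pi fun _ : Fin n => uniformCube d)
  have hjoint : ∀ n, P.map (fun ω i => ξ n i ω) = Measure.pi fun _ : Fin n => uniformCube d := by
    intro n
    rw [(iIndepFun_iff_map_fun_eq_pi_map fun i => (hmeas n i).aemeasurable).1 (hindep n)]
    simp only [hlaw]
  have hev : ∀ j : ℕ, ∀ᵐ ω ∂P, ∀ᶠ n : ℕ in atTop,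
      ¬ (n * (1 / ((j : ℝ) + 1)) ≤
        |(numColoured k (r n) (Set.range fun i => ξ n i ω) : ℝ) - m n|) := by
    intro j
    set ε : ℝ := 1 / ((j : ℝ) + 1) with hε
    have hε0 : 0 < ε := by positivity
    set q := Real.exp (-(ε ^ 2 / 2)) with hq
    have hq1 : q < 1 := Real.exp_lt_one_iff.2 (neg_lt_zero.2 (by positivity))
    have hbound : ∀ n : ℕ, P {ω | n * ε ≤
        |(numColoured k (r n) (Set.range fun i => ξ n i ω) : ℝ) - m n|}
        ≤ ENNReal.ofReal (2 * q ^ n) := by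
      intro n
      have hf := measurable_numColoured_range (d := d) hk (r n) n
      have h := measureReal_bounded_differences_le (U := uniformCube d) hf (C := n)
        (fun x => by
          rw [Nat.abs_cast, Nat.cast_le]
          exact numColoured_range_le hk (r n) x)
        (abs_numColoured_range_update_sub_le hk (r n)) hε0.le
      rw [← ofReal_measureReal]
      refine ENNReal.ofReal_le_ofReal (le_trans (le_of_eq ?_) h)
      rw [← hjoint n, map_measureReal_apply (measurable_pi_lambda _ (hmeas n))
        (measurableSet_le measurable_const (by fun_prop))]
      rw [hjoint n]
      rfl
    refine ae_eventually_notMem (ne_top_of_le_ne_top ?_ (ENNReal.tsum_le_tsum hbound))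
    rw [← ENNReal.ofReal_tsum_of_nonneg (fun n => by positivity)
      ((summable_geometric_of_lt_one (Real.exp_pos _).le hq1).mul_left 2)]
    exact ENNReal.ofReal_ne_top
  filter_upwards [ae_all_iff.2 hev] with ω hω
  rw [Metric.tendsto_atTop']
  intro ε hε
  obtain ⟨j, hj⟩ := exists_nat_one_div_lt hε
  obtain ⟨N, hN⟩ := eventually_atTop.1 (hω j)
  refine ⟨N, fun n hn => ?_⟩
  have hn' : (0 : ℝ) < n := by exact_mod_cast (Nat.zero_le N).trans_lt hn
  have h := not_le.1 (hN n hn.le)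
  rw [dist_zero_right, ← sub_div, norm_div, Real.norm_eq_abs, Real.norm_of_nonneg hn'.le,
    div_lt_iff₀ hn', mul_comm]
  exact h.trans (mul_lt_mul_of_pos_left hj hn')

end BinomialProcess

theorem proposition4 {d : ℕ} (hd : 1 ≤ d) {k : ℕ} (hk : 1 ≤ k) {ν : ℝ} (hν : 0 < ν)
    -- a Poisson point process of intensity `ν` on `ℝ^d`, which defines `a_{k,ν}`
    {Ω' : Type*} [MeasurableSpace Ω'] (P' : Measure Ω') [IsProbabilityMeasure P']
    (X : Ω' → Set (EuclideanSpace ℝ (Fin d))) (hX : IsPoissonPointProcess ν X P')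
    -- for every `n`, a collection of `n` independent uniform points in `[0,1]^d`
    {Ω : Type*} [MeasurableSpace Ω] (P : Measure Ω) [IsProbabilityMeasure P]
    (ξ : (n : ℕ) → Fin n → Ω → EuclideanSpace ℝ (Fin d))
    (hmeas : ∀ n i, Measurable (ξ n i))
    (hunif : ∀ n i, pdf.IsUniform (ξ n i) (cube d 1) P volume)
    (hindep : ∀ n, iIndepFun (ξ n) P) :
    ∀ᵐ ω ∂P, Tendsto
      (fun n : ℕ =>
        (numColoured k ((ν / (n : ℝ)) ^ (1 / (d : ℝ))) (Set.range fun i => ξ n i ω) : ℝ) / (n : ℝ))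
      atTop (𝓝 (colouringConstant X P' k ν)) := by
  have hlaw : ∀ n i, P.map (ξ n i) = uniformCube d := fun n i =>
    (hunif n i).trans (cond_volume_cube d)
  filter_upwards [ae_tendsto_numColoured_sub_integral hk
    (fun n : ℕ => (ν / (n : ℝ)) ^ (1 / (d : ℝ))) hmeas hlaw hindep] with ω hω
  simpa using hω.add (tendsto_integral_numColoured_range_div hd hk hν hX)
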